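/- Let $V$ be a rational vector space of finite dimension $r$. For $k\ge 0$ let $P^kV$ denote the degree-$k$ component of the polynomial (i.e. symmetric) algebra of $V$, let $\Lambda^2$ denote the second exterior power, and let $\mathbf{R}(V)$ be the kernel of the linear map $$\mathfrak m: V\otimes \Lambda^2P^2V\to P^2V\otimes P^3V,\qquad q\otimes(xy\wedge zw)\mapsto xy\otimes zwq-zw\otimes xyq .$$ The group $GL(V)$ acts on $\mathbf{R}(V)$ by functoriality. For a partition $\lambda$ of $n$ let $S(\lambda)$ denote the corresponding Weyl module, i.e. the $GL(V)$-representation given by the image of the Young symmetrizer $c_\lambda$ acting on $V^{\otimes n}$. Then: (i) $\dim\mathbf{R}(V)=6\binom{r+2}{5}$. (ii) $\mathbf{R}(V)$ is isomorphic, as a representation of $GL(V)$, to the Weyl module $S(3,1,1)$ corresponding to the partition $5=3+1+1$, and for $r\ge 3$ this representation is irreducible. (For $r\le 2$ both representations are zero.) -/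

import Mathlib

open scoped TensorProduct

noncomputable section

namespace PentagonalMassey

/-! ### Symmetric powers -/

section Sym

variable {K : Type*} [Field K] {V W U : Type*} [AddCommGroup V] [Module K V] [AddCommGroup W] [Module K W]
  [AddCommGroup U] [Module K U]

/-- `P^k V`: the degree-`k` component of the polynomial (symmetric) algebra of `V`, i.e. the span of
the `k`-fold products of elements of `V` (defined just as Mathlib's `⋀[K]^k V` is). -/
abbrev symPow (K : Type*) [Field K] (k : ℕ) (V : Type*) [AddCommGroup V] [Module K V] :
    Submodule K (SymmetricAlgebra K V) :=
  LinearMap.range (SymmetricAlgebra.ι K V) ^ k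

/-- The algebra homomorphism of symmetric algebras induced by a linear map. -/
def symAlgMap (f : V →ₗ[K] W) : SymmetricAlgebra K V →ₐ[K] SymmetricAlgebra K W :=
  SymmetricAlgebra.lift (SymmetricAlgebra.ι K W ∘ₗ f)

@[simp] theorem symAlgMap_ι (f : V →ₗ[K] W) (v : V) :
    symAlgMap f (SymmetricAlgebra.ι K V v) = SymmetricAlgebra.ι K W (f v) := by
  simp [symAlgMap]

theorem symAlgMap_id : symAlgMap (LinearMap.id : V →ₗ[K] V) = AlgHom.id K _ := by
  apply SymmetricAlgebra.algHom_ext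
  ext v
  simp

theorem symAlgMap_comp (g : W →ₗ[K] U) (f : V →ₗ[K] W) :
    symAlgMap (g ∘ₗ f) = (symAlgMap g).comp (symAlgMap f) := by
  apply SymmetricAlgebra.algHom_ext
  ext v
  simp

theorem symAlgMap_mem (k : ℕ) (f : V →ₗ[K] W) {x : SymmetricAlgebra K V} (hx : x ∈ symPow K k V) :
    symAlgMap f x ∈ symPow K k W := by
  have h : Submodule.map (symAlgMap f).toLinearMap (symPow K k V) ≤ symPow K k W := by
    rw [symPow, Submodule.map_pow]
    refine pow_le_pow_left' ?_ k
    rintro _ ⟨_, ⟨v, rfl⟩, rfl⟩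
    exact ⟨f v, by simp⟩
  exact h ⟨x, hx, rfl⟩

/-- Functoriality of `P^k`. -/
def symPowMap (k : ℕ) (f : V →ₗ[K] W) : symPow K k V →ₗ[K] symPow K k W :=
  (symAlgMap f).toLinearMap.restrict fun _ hx => symAlgMap_mem k f hx

@[simp] theorem coe_symPowMap (k : ℕ) (f : V →ₗ[K] W) (x : symPow K k V) :
    (symPowMap k f x : SymmetricAlgebra K W) = symAlgMap f x := rfl

/-- The product `xy ∈ P^2 V` of two elements of `V`. -/
def symMul (x y : V) : symPow K 2 V :=
  ⟨SymmetricAlgebra.ι K V x * SymmetricAlgebra.ι K V y, by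
    rw [symPow, pow_two]
    exact Submodule.mul_mem_mul ⟨x, rfl⟩ ⟨y, rfl⟩⟩

/-- The multiplication `P^2 V × V → P^3 V`, `(b, q) ↦ bq`. -/
def symMulVec (K : Type*) [Field K] (V : Type*) [AddCommGroup V] [Module K V] :
    symPow K 2 V →ₗ[K] V →ₗ[K] symPow K 3 V :=
  LinearMap.mk₂ K
    (fun b q => ⟨b.1 * SymmetricAlgebra.ι K V q, by
      rw [symPow, pow_succ]
      exact Submodule.mul_mem_mul b.2 ⟨q, rfl⟩⟩)
    (fun b b' q => Subtype.ext (by simp [add_mul]))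
    (fun c b q => Subtype.ext (by simp))
    (fun b q q' => Subtype.ext (by simp [mul_add]))
    (fun c b q => Subtype.ext (by simp))

@[simp] theorem coe_symMulVec (b : symPow K 2 V) (q : V) :
    (symMulVec K V b q : SymmetricAlgebra K V) = b * SymmetricAlgebra.ι K V q := rfl

theorem symPowMap_symMulVec (f : V →ₗ[K] W) (b : symPow K 2 V) (q : V) :
    symPowMap 3 f (symMulVec K V b q) = symMulVec K W (symPowMap 2 f b) (f q) :=
  Subtype.ext (by simp)

end Sym

/-! ### The map `𝔪` and its kernel -/

section Kernel

variable (K : Type*) [Field K] (V : Type*) [AddCommGroup V] [Module K V]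

/-- For fixed `q`, the alternating map `(a, b) ↦ a ⊗ bq - b ⊗ aq` on `P^2 V`. -/
def mAlt (q : V) : (symPow K 2 V) [⋀^Fin 2]→ₗ[K] (symPow K 2 V ⊗[K] symPow K 3 V) where
  toFun v := v 0 ⊗ₜ symMulVec K V (v 1) q - v 1 ⊗ₜ symMulVec K V (v 0) q
  map_update_add' := by
    intro _ v i x y
    fin_cases i <;>
      simp [TensorProduct.add_tmul, TensorProduct.tmul_add] <;> abel
  map_update_smul' := by
    intro _ v i c x
    fin_cases i <;>
      simp [TensorProduct.smul_tmul', TensorProduct.tmul_smul, smul_sub]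
  map_eq_zero_of_eq' := by
    intro v i j hij hne
    fin_cases i <;> fin_cases j <;> simp_all

theorem mAlt_apply (q : V) (v : Fin 2 → symPow K 2 V) :
    mAlt K V q v = v 0 ⊗ₜ symMulVec K V (v 1) q - v 1 ⊗ₜ symMulVec K V (v 0) q := rfl

/-- The linear dependence of `mAlt` on `q`. -/
def mAltLin : V →ₗ[K] (symPow K 2 V) [⋀^Fin 2]→ₗ[K] (symPow K 2 V ⊗[K] symPow K 3 V) where
  toFun := mAlt K V
  map_add' q q' := by
    apply AlternatingMap.ext
    intro v
    simp only [mAlt_apply, AlternatingMap.add_apply, map_add, TensorProduct.tmul_add]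
    abel
  map_smul' c q := by
    apply AlternatingMap.ext
    intro v
    simp only [mAlt_apply, AlternatingMap.smul_apply, map_smul, TensorProduct.tmul_smul, smul_sub,
      RingHom.id_apply]

/-- The linear map `𝔪 : V ⊗ Λ²P²V → P²V ⊗ P³V`, determined by
`q ⊗ (a ∧ b) ↦ a ⊗ bq - b ⊗ aq`. -/
def mMap : V ⊗[K] (⋀[K]^2 (symPow K 2 V)) →ₗ[K] symPow K 2 V ⊗[K] symPow K 3 V :=
  TensorProduct.lift
    ((exteriorPower.alternatingMapLinearEquiv (R := K) (n := 2) (M := symPow K 2 V)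
      (N := symPow K 2 V ⊗[K] symPow K 3 V)).toLinearMap ∘ₗ mAltLin K V)

theorem mMap_tmul_wedge (q : V) (v : Fin 2 → symPow K 2 V) :
    mMap K V (q ⊗ₜ exteriorPower.ιMulti K 2 v) =
      v 0 ⊗ₜ symMulVec K V (v 1) q - v 1 ⊗ₜ symMulVec K V (v 0) q := by
  rw [mMap, TensorProduct.lift.tmul]
  exact exteriorPower.alternatingMapLinearEquiv_apply_ιMulti _ _

/-- The defining formula: `𝔪(q ⊗ (xy ∧ zw)) = xy ⊗ zwq - zw ⊗ xyq`. -/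
theorem mMap_monomial (q x y z w : V) :
    mMap K V (q ⊗ₜ exteriorPower.ιMulti K 2 ![symMul x y, symMul z w]) =
      symMul x y ⊗ₜ symMulVec K V (symMul z w) q - symMul z w ⊗ₜ symMulVec K V (symMul x y) q := by
  rw [mMap_tmul_wedge]
  rfl

/-- `R(V) = ker 𝔪`. -/
def R : Submodule K (V ⊗[K] (⋀[K]^2 (symPow K 2 V))) := LinearMap.ker (mMap K V)

/-- The tautological representation of `GL(V)` on `V`. -/
def stdRep : Representation K (LinearMap.GeneralLinearGroup K V) V where
  toFun g := (g : V →ₗ[K] V)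
  map_one' := rfl
  map_mul' _ _ := rfl

/-- The representation of `GL(V)` on `Λ²P²V` induced by functoriality. -/
def extSymRep :
    Representation K (LinearMap.GeneralLinearGroup K V) (⋀[K]^2 (symPow K 2 V)) where
  toFun g := exteriorPower.map 2 (symPowMap 2 (stdRep K V g))
  map_one' := by
    have : symPowMap 2 (stdRep K V 1) = LinearMap.id := by
      ext x
      rw [map_one, Module.End.one_eq_id, coe_symPowMap, symAlgMap_id]
      rfl
    rw [this, exteriorPower.map_id]
    rfl
  map_mul' g h := by
    have : symPowMap 2 (stdRep K V (g * h)) =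
        symPowMap 2 (stdRep K V g) ∘ₗ symPowMap 2 (stdRep K V h) := by
      ext x
      rw [map_mul, Module.End.mul_eq_comp, coe_symPowMap, symAlgMap_comp]
      rfl
    rw [this]
    exact exteriorPower.map_comp (n := 2) (symPowMap 2 (stdRep K V h))
      (symPowMap 2 (stdRep K V g))

/-- The representation of `GL(V)` on `V ⊗ Λ²P²V`. -/
def ambientRep :
    Representation K (LinearMap.GeneralLinearGroup K V) (V ⊗[K] (⋀[K]^2 (symPow K 2 V))) :=
  (stdRep K V).tprod (extSymRep K V)

theorem mMap_equivariant (g : LinearMap.GeneralLinearGroup K V) :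
    mMap K V ∘ₗ ambientRep K V g =
      TensorProduct.map (symPowMap 2 (stdRep K V g)) (symPowMap 3 (stdRep K V g)) ∘ₗ mMap K V := by
  apply TensorProduct.ext
  apply LinearMap.ext
  intro q
  refine exteriorPower.linearMap_ext (R := K) (n := 2) (M := symPow K 2 V)
      (N := symPow K 2 V ⊗[K] symPow K 3 V) ?_
  apply AlternatingMap.ext
  intro v
  change mMap K V (stdRep K V g q ⊗ₜ exteriorPower.map 2 (symPowMap 2 (stdRep K V g))
      (exteriorPower.ιMulti K 2 v)) =
    TensorProduct.map (symPowMap 2 (stdRep K V g)) (symPowMap 3 (stdRep K V g))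
      (mMap K V (q ⊗ₜ exteriorPower.ιMulti K 2 v))
  rw [exteriorPower.map_apply_ιMulti, mMap_tmul_wedge, mMap_tmul_wedge, map_sub,
    TensorProduct.map_tmul, TensorProduct.map_tmul, symPowMap_symMulVec, symPowMap_symMulVec]
  rfl

theorem ambientRep_mem_R (g : LinearMap.GeneralLinearGroup K V)
    {t : V ⊗[K] (⋀[K]^2 (symPow K 2 V))} (ht : t ∈ R K V) : ambientRep K V g t ∈ R K V := by
  have h0 : mMap K V t = 0 := ht
  have h : mMap K V (ambientRep K V g t) =
      TensorProduct.map (symPowMap 2 (stdRep K V g)) (symPowMap 3 (stdRep K V g)) (mMap K V t) :=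
    LinearMap.congr_fun (mMap_equivariant K V g) t
  rw [h0, LinearMap.map_zero] at h
  exact h

/-- `R(V)` as a subrepresentation of the `GL(V)`-representation `V ⊗ Λ²P²V`. -/
def RSubrep : Subrepresentation (ambientRep K V) where
  toSubmodule := R K V
  apply_mem_toSubmodule g _ ht := ambientRep_mem_R K V g ht

/-- `R(V)` as a representation of `GL(V)`. -/
def RRep : Representation K (LinearMap.GeneralLinearGroup K V) (R K V) :=
  (RSubrep K V).toRepresentation

theorem coe_RRep_apply (g : LinearMap.GeneralLinearGroup K V) (t : R K V) :
    (RRep K V g t : V ⊗[K] (⋀[K]^2 (symPow K 2 V))) =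
      TensorProduct.map (g : V →ₗ[K] V)
        (exteriorPower.map 2 (symPowMap 2 (g : V →ₗ[K] V))) t := rfl

end Kernel

/-! ### Weyl modules -/

section Weyl

variable (K : Type*) [Field K] (μ : YoungDiagram) (V : Type*) [AddCommGroup V] [Module K V]

/-- The tensor power `V^{⊗n}`, with its `n = |μ|` factors indexed by the cells of `μ`. -/
abbrev cellTensor : Type _ := ⨂[K] _ : μ.cells, V

/-- The action of a permutation of the cells on `V^{⊗n}`, permuting the tensor factors. -/
def permTensor (σ : Equiv.Perm μ.cells) : cellTensor K μ V →ₗ[K] cellTensor K μ V :=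
  (PiTensorProduct.reindex K (fun _ : μ.cells => V) σ).toLinearMap

/-- `a_μ`: the sum over all permutations preserving each row. -/
def rowSymmetrizer : cellTensor K μ V →ₗ[K] cellTensor K μ V :=
  ∑ σ : Equiv.Perm μ.cells with ∀ c, (σ c).1.1 = c.1.1, permTensor K μ V σ

/-- `b_μ`: the signed sum over all permutations preserving each column. -/
def colAntisymmetrizer : cellTensor K μ V →ₗ[K] cellTensor K μ V :=
  ∑ σ : Equiv.Perm μ.cells with ∀ c, (σ c).1.2 = c.1.2,
    ((Equiv.Perm.sign σ : ℤ) : K) • permTensor K μ V σ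

/-- The Young symmetrizer `c_μ`: symmetrize along the rows, then antisymmetrize along the
columns. -/
def youngSymmetrizer : cellTensor K μ V →ₗ[K] cellTensor K μ V :=
  colAntisymmetrizer K μ V ∘ₗ rowSymmetrizer K μ V

/-- The Weyl module `S(μ)`: the image of the Young symmetrizer on `V^{⊗n}`. -/
def weyl : Submodule K (cellTensor K μ V) := LinearMap.range (youngSymmetrizer K μ V)

/-- The diagonal representation of `GL(V)` on `V^{⊗n}`. -/
def tensorRep : Representation K (LinearMap.GeneralLinearGroup K V) (cellTensor K μ V) where
  toFun g := PiTensorProduct.map fun _ => stdRep K V g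
  map_one' := by
    simp only [map_one]
    exact PiTensorProduct.map_one
  map_mul' g h := by
    simp only [map_mul]
    exact PiTensorProduct.map_mul _ _

theorem permTensor_equivariant (g : LinearMap.GeneralLinearGroup K V)
    (σ : Equiv.Perm μ.cells) (x : cellTensor K μ V) :
    permTensor K μ V σ (tensorRep K μ V g x) = tensorRep K μ V g (permTensor K μ V σ x) :=
  (PiTensorProduct.map_reindex (fun _ => stdRep K V g) σ x).symm

theorem youngSymmetrizer_equivariant (g : LinearMap.GeneralLinearGroup K V)
    (x : cellTensor K μ V) :
    youngSymmetrizer K μ V (tensorRep K μ V g x) =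
      tensorRep K μ V g (youngSymmetrizer K μ V x) := by
  have hrow : ∀ y, rowSymmetrizer K μ V (tensorRep K μ V g y) =
      tensorRep K μ V g (rowSymmetrizer K μ V y) := by
    intro y
    rw [rowSymmetrizer, LinearMap.sum_apply, LinearMap.sum_apply, map_sum]
    exact Finset.sum_congr rfl fun σ _ => permTensor_equivariant K μ V g σ y
  have hcol : ∀ y, colAntisymmetrizer K μ V (tensorRep K μ V g y) =
      tensorRep K μ V g (colAntisymmetrizer K μ V y) := by
    intro y
    rw [colAntisymmetrizer, LinearMap.sum_apply, LinearMap.sum_apply, map_sum]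
    refine Finset.sum_congr rfl fun σ _ => ?_
    rw [LinearMap.smul_apply, LinearMap.smul_apply, map_smul, permTensor_equivariant]
  rw [youngSymmetrizer, LinearMap.comp_apply, LinearMap.comp_apply, hrow, hcol]

/-- `S(μ)` as a subrepresentation of the `GL(V)`-representation `V^{⊗n}`. -/
def weylSubrep : Subrepresentation (tensorRep K μ V) where
  toSubmodule := weyl K μ V
  apply_mem_toSubmodule := by
    rintro g _ ⟨x, rfl⟩
    exact ⟨tensorRep K μ V g x, youngSymmetrizer_equivariant K μ V g x⟩

/-- `S(μ)` as a representation of `GL(V)`. -/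
def weylRep : Representation K (LinearMap.GeneralLinearGroup K V) (weyl K μ V) :=
  (weylSubrep K μ V).toRepresentation

theorem coe_weylRep_apply (g : LinearMap.GeneralLinearGroup K V) (t : weyl K μ V) :
    (weylRep K μ V g t : cellTensor K μ V) =
      PiTensorProduct.map (fun _ => (g : V →ₗ[K] V)) (t : cellTensor K μ V) := rfl

end Weyl

/-- The partition `5 = 3 + 1 + 1`. -/
def hook311 : YoungDiagram := YoungDiagram.ofRowLens [3, 1, 1] (by decide)

end PentagonalMassey

end

noncomputable section

namespace PentagonalMassey

namespace Hook

/-! ### Tensors indexed by the cells of the hook `3 + 1 + 1` -/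

/-! The idea is to produce explicit maps in both directions. Write `c = b ∘ a` for the Young
symmetrizer, with `a` the row symmetrizer and `b` the column antisymmetrizer. Sending `p ⊗ q ⊗ r ⊗ y
⊗ z` to `p ⊗ (yq ∧ zr)` (`toAmb`) maps `V^{⊗5}` to `V ⊗ Λ²P²V`; in the other direction, both
quadratic factors are polarized (`ofAmb`) and `b` is applied. By polarization, `S(3,1,1)` is spanned
by the vectors `hookVec x y z = b(x ⊗ x ⊗ x ⊗ y ⊗ z)`. Each goes to twice `x ⊗ (xy ∧ xz) - y ⊗ (x² ∧
xz) + z ⊗ (x² ∧ xy)`, which `𝔪` kills.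

The two composites are governed by the product `5·2·1·2·1 = 20` of the hook lengths: `b ∘ ofAmb ∘
toAmb = 20` on `S(3,1,1)`, and `toAmb ∘ b ∘ ofAmb + retract ∘ 𝔪 = 20` on all of `V ⊗ Λ²P²V`. The
correction term vanishes on `R(V)`. Since also `c ∘ b ∘ ofAmb = 20 b ∘ ofAmb`, the image of `b ∘
ofAmb` lies in `S(3,1,1)`, and `toAmb` restricts to an isomorphism onto `R(V)`. All these identities
are checked on spanning vectors.

The same identities show that `c / 20` is a projection onto `S(3,1,1)`, so the dimension is `tr(c) /
20`, a polynomial in `r`.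

For irreducibility, a nonzero `GL(V)`-stable `W ⊆ S(3,1,1)` is stable under `End(V)`, because `A +
t` is invertible for almost all `t` and acts polynomially in `t`. Some `φ ⊗ φ ⊗ φ ⊗ χ ⊗ ψ` pairs
nontrivially with some `w` in `W`. The `t³` coefficient of the action on `w` of `v ↦ tφ(v)x + χ(v)y
+ ψ(v)z` is that pairing times `hookVec x y z`. Hence `W` contains every `hookVec x y z`. -/

/-- The cell in the corner of the hook. -/
abbrev c00 : hook311.cells := ⟨(0, 0), by decide⟩
/-- The second cell of the first row. -/
abbrev c01 : hook311.cells := ⟨(0, 1), by decide⟩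
/-- The third cell of the first row. -/
abbrev c02 : hook311.cells := ⟨(0, 2), by decide⟩
/-- The second cell of the first column. -/
abbrev c10 : hook311.cells := ⟨(1, 0), by decide⟩
/-- The third cell of the first column. -/
abbrev c20 : hook311.cells := ⟨(2, 0), by decide⟩

theorem univ_cells : (Finset.univ : Finset hook311.cells) = {c00, c01, c02, c10, c20} := by decide

theorem forall_cells {p : hook311.cells → Prop} :
    (∀ c, p c) ↔ p c00 ∧ p c01 ∧ p c02 ∧ p c10 ∧ p c20 := by
  have h : (∀ c, p c) ↔ ∀ c ∈ (Finset.univ : Finset hook311.cells), p c := by simp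
  rw [h, univ_cells]
  simp only [Finset.forall_mem_insert, Finset.mem_singleton, forall_eq]

open Equiv in
set_option maxRecDepth 100000 in
theorem rowPerms : (Finset.univ.filter fun σ : Perm hook311.cells => ∀ c, (σ c).1.1 = c.1.1) =
    {1, swap c00 c01, swap c00 c02, swap c01 c02, swap c00 c01 * swap c01 c02,
      swap c01 c02 * swap c00 c01} := by
  decide +kernel

open Equiv in
set_option maxRecDepth 100000 in
theorem colPerms : (Finset.univ.filter fun σ : Perm hook311.cells => ∀ c, (σ c).1.2 = c.1.2) =
    {1, swap c00 c10, swap c00 c20, swap c10 c20, swap c00 c10 * swap c10 c20,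
      swap c10 c20 * swap c00 c10} := by
  decide +kernel


variable {V W : Type*} [AddCommGroup V] [Module ℚ V] [AddCommGroup W] [Module ℚ W]

/-- The function on the cells of the hook with the given values. -/
def vec {X : Type*} (p q r y z : X) : hook311.cells → X := fun c =>
  if c = c00 then p else if c = c01 then q else if c = c02 then r else if c = c10 then y else z

section vec
variable {X : Type*} (p q r y z : X)
@[simp] theorem vec_c00 : vec p q r y z c00 = p := rfl
@[simp] theorem vec_c01 : vec p q r y z c01 = q := rfl
@[simp] theorem vec_c02 : vec p q r y z c02 = r := rfl
@[simp] theorem vec_c10 : vec p q r y z c10 = y := rfl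
@[simp] theorem vec_c20 : vec p q r y z c20 = z := rfl

theorem eq_vec (f : hook311.cells → X) : f = vec (f c00) (f c01) (f c02) (f c10) (f c20) :=
  funext <| forall_cells.2 ⟨rfl, rfl, rfl, rfl, rfl⟩

theorem comp_vec {Y : Type*} (g : X → Y) :
    (fun c => g (vec p q r y z c)) = vec (g p) (g q) (g r) (g y) (g z) :=
  eq_vec _

theorem prod_cells (f : hook311.cells → ℚ) : ∏ c, f c = f c00 * f c01 * f c02 * f c10 * f c20 := by
  rw [univ_cells]
  rw [Finset.prod_insert (by decide), Finset.prod_insert (by decide), Finset.prod_insert (by decide),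
    Finset.prod_insert (by decide), Finset.prod_singleton]
  ring

/-- Functions on the cells of the hook are quintuples. -/
def vecEquiv (X : Type*) : X × X × X × X × X ≃ (hook311.cells → X) where
  toFun t := vec t.1 t.2.1 t.2.2.1 t.2.2.2.1 t.2.2.2.2
  invFun f := (f c00, f c01, f c02, f c10, f c20)
  left_inv _ := rfl
  right_inv f := (eq_vec f).symm

end vec

/-- The decomposable tensor with the given factors. -/
def T (p q r y z : V) : cellTensor ℚ hook311 V := PiTensorProduct.tprod ℚ (vec p q r y z)

/-- A map additive in each cell gives a multilinear map. -/
def multilinear (F : V → V → V → V → V → W)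
    (h0 : ∀ q r y z, IsLinearMap ℚ fun p => F p q r y z)
    (h1 : ∀ p r y z, IsLinearMap ℚ fun q => F p q r y z)
    (h2 : ∀ p q y z, IsLinearMap ℚ fun r => F p q r y z)
    (h3 : ∀ p q r z, IsLinearMap ℚ fun y => F p q r y z)
    (h4 : ∀ p q r y, IsLinearMap ℚ fun z => F p q r y z) :
    MultilinearMap ℚ (fun _ : hook311.cells => V) W where
  toFun v := F (v c00) (v c01) (v c02) (v c10) (v c20)
  map_update_add' := by
    intro inst v c x y
    -- The decidability instance is arbitrary here; fixing a concrete one lets `Function.update` at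
    -- explicit cells compute definitionally.
    rw [Subsingleton.elim inst (instDecidableEqOfLawfulBEq)]
    revert c
    refine forall_cells.2 ⟨?_, ?_, ?_, ?_, ?_⟩
    · exact (h0 _ _ _ _).map_add x y
    · exact (h1 _ _ _ _).map_add x y
    · exact (h2 _ _ _ _).map_add x y
    · exact (h3 _ _ _ _).map_add x y
    · exact (h4 _ _ _ _).map_add x y
  map_update_smul' := by
    intro inst v c t x
    rw [Subsingleton.elim inst (instDecidableEqOfLawfulBEq)]
    revert c
    refine forall_cells.2 ⟨?_, ?_, ?_, ?_, ?_⟩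
    · exact (h0 _ _ _ _).map_smul t x
    · exact (h1 _ _ _ _).map_smul t x
    · exact (h2 _ _ _ _).map_smul t x
    · exact (h3 _ _ _ _).map_smul t x
    · exact (h4 _ _ _ _).map_smul t x

theorem isLinearMap_tprod (c : hook311.cells) (v : hook311.cells → V)
    (F : V → hook311.cells → V) (h : ∀ x, Function.update v c x = F x) :
    IsLinearMap ℚ fun x => PiTensorProduct.tprod ℚ (F x) := by
  simp_rw [← h]
  exact ((PiTensorProduct.tprod ℚ).toLinearMap v c).isLinear

section T
variable (p q r y z : V)

theorem isLinear_T00 : IsLinearMap ℚ fun p => T p q r y z :=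
  isLinearMap_tprod c00 (vec 0 q r y z) _ fun _ => eq_vec _
theorem isLinear_T01 : IsLinearMap ℚ fun q => T p q r y z :=
  isLinearMap_tprod c01 (vec p 0 r y z) _ fun _ => eq_vec _
theorem isLinear_T02 : IsLinearMap ℚ fun r => T p q r y z :=
  isLinearMap_tprod c02 (vec p q 0 y z) _ fun _ => eq_vec _
theorem isLinear_T10 : IsLinearMap ℚ fun y => T p q r y z :=
  isLinearMap_tprod c10 (vec p q r 0 z) _ fun _ => eq_vec _
theorem isLinear_T20 : IsLinearMap ℚ fun z => T p q r y z :=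
  isLinearMap_tprod c20 (vec p q r y 0) _ fun _ => eq_vec _

theorem T_add00 (p' : V) : T (p + p') q r y z = T p q r y z + T p' q r y z :=
  (isLinear_T00 q r y z).map_add _ _
theorem T_add01 (q' : V) : T p (q + q') r y z = T p q r y z + T p q' r y z :=
  (isLinear_T01 p r y z).map_add _ _
theorem T_add02 (r' : V) : T p q (r + r') y z = T p q r y z + T p q r' y z :=
  (isLinear_T02 p q y z).map_add _ _
theorem T_add10 (y' : V) : T p q r (y + y') z = T p q r y z + T p q r y' z :=
  (isLinear_T10 p q r z).map_add _ _
theorem T_add20 (z' : V) : T p q r y (z + z') = T p q r y z + T p q r y z' :=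
  (isLinear_T20 p q r y).map_add _ _
theorem T_smul00 (t : ℚ) : T (t • p) q r y z = t • T p q r y z :=
  (isLinear_T00 q r y z).map_smul _ _
theorem T_smul01 (t : ℚ) : T p (t • q) r y z = t • T p q r y z :=
  (isLinear_T01 p r y z).map_smul _ _
theorem T_smul02 (t : ℚ) : T p q (t • r) y z = t • T p q r y z :=
  (isLinear_T02 p q y z).map_smul _ _
theorem T_smul10 (t : ℚ) : T p q r (t • y) z = t • T p q r y z :=
  (isLinear_T10 p q r z).map_smul _ _
theorem T_smul20 (t : ℚ) : T p q r y (t • z) = t • T p q r y z :=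
  (isLinear_T20 p q r y).map_smul _ _

/-- Linear maps on the tensor power agree if they agree on decomposable tensors. -/
theorem ext_T {f g : cellTensor ℚ hook311 V →ₗ[ℚ] W}
    (h : ∀ p q r y z, f (T p q r y z) = g (T p q r y z)) : f = g := by
  apply PiTensorProduct.ext
  ext v
  simp only [LinearMap.compMultilinearMap_apply]
  rw [eq_vec v]
  exact h _ _ _ _ _

theorem map_T (A : V →ₗ[ℚ] W) :
    PiTensorProduct.map (fun _ => A) (T p q r y z) = T (A p) (A q) (A r) (A y) (A z) := by
  rw [T, PiTensorProduct.map_tprod, comp_vec, T]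

theorem lift_T (F : V → V → V → V → V → W) (h0 h1 h2 h3 h4) :
    PiTensorProduct.lift (multilinear F h0 h1 h2 h3 h4) (T p q r y z) = F p q r y z := by
  rw [T, PiTensorProduct.lift.tprod]
  rfl

/-- Reindexing moves the factor at `c` to `σ c`, so the cell `c` receives the factor from `σ⁻¹ c`.
-/
theorem permTensor_T (σ : Equiv.Perm hook311.cells) :
    permTensor ℚ hook311 V σ (T p q r y z) =
      T (vec p q r y z (σ.symm c00)) (vec p q r y z (σ.symm c01)) (vec p q r y z (σ.symm c02))
        (vec p q r y z (σ.symm c10)) (vec p q r y z (σ.symm c20)) := by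
  rw [permTensor, LinearEquiv.coe_coe, T, PiTensorProduct.reindex_tprod, T]
  exact congrArg _ (eq_vec _)

theorem rowSymmetrizer_T : rowSymmetrizer ℚ hook311 V (T p q r y z) =
    T p q r y z + T q p r y z + T r q p y z + T p r q y z + T r p q y z + T q r p y z := by
  rw [rowSymmetrizer, rowPerms]
  rw [Finset.sum_insert (by decide), Finset.sum_insert (by decide), Finset.sum_insert (by decide),
    Finset.sum_insert (by decide), Finset.sum_insert (by decide), Finset.sum_singleton]
  simp only [LinearMap.add_apply, permTensor_T, ← add_assoc]
  rfl

theorem colAntisymmetrizer_T : colAntisymmetrizer ℚ hook311 V (T p q r y z) =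
    T p q r y z - T y q r p z - T z q r y p - T p q r z y + T z q r p y + T y q r z p := by
  rw [colAntisymmetrizer, colPerms]
  rw [Finset.sum_insert (by decide), Finset.sum_insert (by decide), Finset.sum_insert (by decide),
    Finset.sum_insert (by decide), Finset.sum_insert (by decide), Finset.sum_singleton]
  have h1 : Equiv.Perm.sign (Equiv.swap c00 c10) = -1 := Equiv.Perm.sign_swap (by decide)
  have h2 : Equiv.Perm.sign (Equiv.swap c00 c20) = -1 := Equiv.Perm.sign_swap (by decide)
  have h3 : Equiv.Perm.sign (Equiv.swap c10 c20) = -1 := Equiv.Perm.sign_swap (by decide)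
  simp only [LinearMap.add_apply, LinearMap.smul_apply, permTensor_T, ← add_assoc,
    Equiv.Perm.sign_mul, h1, h2, h3, Equiv.Perm.sign_one, Units.val_neg, Units.val_one,
    Int.cast_neg, Int.cast_one, neg_smul, one_smul, mul_neg, neg_neg, mul_one,
    ← sub_eq_add_neg]
  rfl

/-- Polarization: the row symmetrization of a tensor is a combination of tensors that are constant
on the first row. -/
theorem rowSymmetrizer_T_polarization : rowSymmetrizer ℚ hook311 V (T p q r y z) =
    T (p + q + r) (p + q + r) (p + q + r) y z - T (p + q) (p + q) (p + q) y z
      - T (p + r) (p + r) (p + r) y z - T (q + r) (q + r) (q + r) y z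
      + T p p p y z + T q q q y z + T r r r y z := by
  simp only [rowSymmetrizer_T, T_add00, T_add01, T_add02]
  abel

theorem rowSymmetrizer_T_diag : rowSymmetrizer ℚ hook311 V (T p p p y z) = (6 : ℚ) • T p p p y z := by
  rw [rowSymmetrizer_T]
  module

end T

end Hook
end PentagonalMassey
end

noncomputable section

namespace PentagonalMassey

/-! ### Symmetric squares and cubes -/

section SymLow

variable {V W : Type*} [AddCommGroup V] [Module ℚ V] [AddCommGroup W] [Module ℚ W]

theorem symMul_comm (x y : V) : symMul (K := ℚ) x y = symMul y x :=
  Subtype.ext (mul_comm _ _)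

variable (V) in
/-- The product `V × V → P²V` as a bilinear map. -/
def symMulLin : V →ₗ[ℚ] V →ₗ[ℚ] symPow ℚ 2 V :=
  LinearMap.mk₂ ℚ symMul
    (fun x x' y => Subtype.ext (by simp [symMul, add_mul]))
    (fun c x y => Subtype.ext (by simp [symMul]))
    (fun x y y' => Subtype.ext (by simp [symMul, mul_add]))
    (fun c x y => Subtype.ext (by simp [symMul]))

theorem symMul_add_left (x x' y : V) : symMul (K := ℚ) (x + x') y = symMul x y + symMul x' y :=
  LinearMap.map_add₂ (symMulLin V) x x' y
theorem symMul_add_right (x y y' : V) : symMul (K := ℚ) x (y + y') = symMul x y + symMul x y' :=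
  (symMulLin V x).map_add y y'
theorem symMul_smul_left (c : ℚ) (x y : V) : symMul (K := ℚ) (c • x) y = c • symMul x y :=
  LinearMap.map_smul₂ (symMulLin V) c x y
theorem symMul_smul_right (c : ℚ) (x y : V) : symMul (K := ℚ) x (c • y) = c • symMul x y :=
  (symMulLin V x).map_smul c y

theorem symPowMap_symMul (f : V →ₗ[ℚ] W) (x y : V) :
    symPowMap 2 f (symMul (K := ℚ) x y) = symMul (f x) (f y) :=
  Subtype.ext (by simp [symMul])

/-- Linear maps on `P²V` agree if they agree on squares. -/
theorem symPow_two_ext {f g : symPow ℚ 2 V →ₗ[ℚ] W}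
    (h : ∀ x, f (symMul x x) = g (symMul x x)) : f = g := by
  have h2 (x y : V) : f (symMul x y) = g (symMul x y) := by
    have e : symMul (K := ℚ) x y =
        (1 / 2 : ℚ) • (symMul (x + y) (x + y) - symMul x x - symMul y y) := by
      simp only [symMul_add_left, symMul_add_right, symMul_comm y x]
      module
    rw [e]
    simp only [map_smul, map_sub, h]
  apply LinearMap.ext
  rintro ⟨b, hb⟩
  have hb' : b ∈ LinearMap.range (SymmetricAlgebra.ι ℚ V) * LinearMap.range (SymmetricAlgebra.ι ℚ V) := by
    rwa [← pow_two]
  -- The induction runs over elements of the ambient algebra, so membership in `P²V` is carried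
  -- inside the predicate.
  suffices H : ∃ hb, f ⟨b, hb⟩ = g ⟨b, hb⟩ from H.2
  refine Submodule.mul_induction_on hb' ?_ ?_
  · rintro _ ⟨x, rfl⟩ _ ⟨y, rfl⟩
    exact ⟨_, h2 x y⟩
  · rintro x y ⟨hx', hx⟩ ⟨hy', hy⟩
    refine ⟨Submodule.add_mem _ hx' hy', ?_⟩
    have e : (⟨x + y, Submodule.add_mem _ hx' hy'⟩ : symPow ℚ 2 V) = ⟨x, hx'⟩ + ⟨y, hy'⟩ := rfl
    rw [e, map_add, map_add, hx, hy]

/-! ### Differentiation and polarization of quadrics and cubics -/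

/-- The directional derivative along a linear form, as the infinitesimal part of the algebra
homomorphism `v ↦ v + φ(v) ε` to the dual numbers. -/
def partialDeriv (φ : V →ₗ[ℚ] ℚ) : SymmetricAlgebra ℚ V →ₗ[ℚ] SymmetricAlgebra ℚ V :=
  (TrivSqZeroExt.sndHom _ _).restrictScalars ℚ ∘ₗ
    (SymmetricAlgebra.lift (A := DualNumber (SymmetricAlgebra ℚ V))
      ((TrivSqZeroExt.inlAlgHom ℚ _ _).toLinearMap ∘ₗ SymmetricAlgebra.ι ℚ V +
        (TrivSqZeroExt.inrHom _ _).restrictScalars ℚ ∘ₗ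
          Algebra.linearMap ℚ (SymmetricAlgebra ℚ V) ∘ₗ φ)).toLinearMap

theorem partialDeriv_ι (φ : V →ₗ[ℚ] ℚ) (v : V) :
    partialDeriv φ (SymmetricAlgebra.ι ℚ V v) = algebraMap ℚ _ (φ v) := by
  simp [partialDeriv, Algebra.algebraMap_eq_smul_one]

theorem partialDeriv_mul_ι_two (φ : V →ₗ[ℚ] ℚ) (x y : V) :
    partialDeriv φ (SymmetricAlgebra.ι ℚ V x * SymmetricAlgebra.ι ℚ V y) =
      φ x • SymmetricAlgebra.ι ℚ V y + φ y • SymmetricAlgebra.ι ℚ V x := by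
  simp [partialDeriv]
  simp only [Algebra.smul_def]
  ring

theorem partialDeriv_mul_ι_three (φ : V →ₗ[ℚ] ℚ) (x y z : V) :
    partialDeriv φ (SymmetricAlgebra.ι ℚ V x * SymmetricAlgebra.ι ℚ V y *
        SymmetricAlgebra.ι ℚ V z) =
      φ x • (SymmetricAlgebra.ι ℚ V y * SymmetricAlgebra.ι ℚ V z) +
      φ y • (SymmetricAlgebra.ι ℚ V x * SymmetricAlgebra.ι ℚ V z) +
      φ z • (SymmetricAlgebra.ι ℚ V x * SymmetricAlgebra.ι ℚ V y) := by
  simp [partialDeriv]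
  simp only [Algebra.smul_def]
  ring

variable [FiniteDimensional ℚ V]

variable (V) in
/-- The differential `f ↦ ∑ eᵢ ⊗ ∂ᵢ f` of a polynomial. -/
def differential : SymmetricAlgebra ℚ V →ₗ[ℚ] V ⊗[ℚ] SymmetricAlgebra ℚ V :=
  ∑ i, TensorProduct.mk ℚ V (SymmetricAlgebra ℚ V) (Module.finBasis ℚ V i) ∘ₗ
    partialDeriv ((Module.finBasis ℚ V).coord i)

theorem sum_smul_basis_tmul (x : V) (t : SymmetricAlgebra ℚ V) :
    ∑ i, ((Module.finBasis ℚ V).repr x i • Module.finBasis ℚ V i) ⊗ₜ[ℚ] t = x ⊗ₜ t := by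
  rw [← TensorProduct.sum_tmul, Module.Basis.sum_repr]

theorem differential_ι (x : V) : differential V (SymmetricAlgebra.ι ℚ V x) = x ⊗ₜ 1 := by
  simp only [differential, LinearMap.sum_apply, LinearMap.comp_apply, partialDeriv_ι,
    TensorProduct.mk_apply, Algebra.algebraMap_eq_smul_one, TensorProduct.tmul_smul,
    TensorProduct.smul_tmul', Module.Basis.coord_apply, sum_smul_basis_tmul]

theorem differential_mul_two (x y : V) :
    differential V (SymmetricAlgebra.ι ℚ V x * SymmetricAlgebra.ι ℚ V y) =
      x ⊗ₜ SymmetricAlgebra.ι ℚ V y + y ⊗ₜ SymmetricAlgebra.ι ℚ V x := by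
  simp only [differential, LinearMap.sum_apply, LinearMap.comp_apply, partialDeriv_mul_ι_two,
    TensorProduct.mk_apply, TensorProduct.tmul_add, TensorProduct.tmul_smul,
    Finset.sum_add_distrib, TensorProduct.smul_tmul',
    Module.Basis.coord_apply, sum_smul_basis_tmul]

theorem differential_mul_three (x y z : V) :
    differential V (SymmetricAlgebra.ι ℚ V x * SymmetricAlgebra.ι ℚ V y *
        SymmetricAlgebra.ι ℚ V z) =
      x ⊗ₜ (SymmetricAlgebra.ι ℚ V y * SymmetricAlgebra.ι ℚ V z) +
      y ⊗ₜ (SymmetricAlgebra.ι ℚ V x * SymmetricAlgebra.ι ℚ V z) +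
      z ⊗ₜ (SymmetricAlgebra.ι ℚ V x * SymmetricAlgebra.ι ℚ V y) := by
  simp only [differential, LinearMap.sum_apply, LinearMap.comp_apply, partialDeriv_mul_ι_three,
    TensorProduct.mk_apply, TensorProduct.tmul_add, TensorProduct.tmul_smul,
    Finset.sum_add_distrib, TensorProduct.smul_tmul',
    Module.Basis.coord_apply, sum_smul_basis_tmul]

variable (V) in
/-- The linear part of a polynomial. -/
def linearPart : SymmetricAlgebra ℚ V →ₗ[ℚ] V :=
  (TensorProduct.rid ℚ V).toLinearMap ∘ₗ
    LinearMap.lTensor V (SymmetricAlgebra.algebraMapInv (R := ℚ) (M := V)).toLinearMap ∘ₗ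
      differential V

theorem linearPart_ι (x : V) : linearPart V (SymmetricAlgebra.ι ℚ V x) = x := by
  simp [linearPart, differential_ι]

variable (V) in
/-- Polarization `P²V → V ⊗ V`, `xy ↦ x ⊗ y + y ⊗ x`. -/
def polarTwo : symPow ℚ 2 V →ₗ[ℚ] V ⊗[ℚ] V :=
  LinearMap.lTensor V (linearPart V) ∘ₗ differential V ∘ₗ (symPow ℚ 2 V).subtype

theorem polarTwo_symMul (x y : V) : polarTwo V (symMul x y) = x ⊗ₜ y + y ⊗ₜ x := by
  simp [polarTwo, symMul, differential_mul_two, linearPart_ι]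

variable (V) in
/-- Polarization `P³V → V ⊗ P²V`, `xyz ↦ x ⊗ yz + y ⊗ xz + z ⊗ xy`. -/
def polarThree : symPow ℚ 3 V →ₗ[ℚ] V ⊗[ℚ] symPow ℚ 2 V :=
  -- The derivatives of a cubic are already quadratic; an arbitrary linear retraction onto `P²V`
  -- serves only to change the codomain.
  LinearMap.lTensor V
      ((symPow ℚ 2 V).subtype.exists_leftInverse_of_injective (symPow ℚ 2 V).ker_subtype).choose ∘ₗ
    differential V ∘ₗ (symPow ℚ 3 V).subtype

theorem polarThree_symMulVec (x y z : V) : polarThree V (symMulVec ℚ V (symMul x y) z) =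
    x ⊗ₜ symMul y z + y ⊗ₜ symMul x z + z ⊗ₜ symMul x y := by
  have h := ((symPow ℚ 2 V).subtype.exists_leftInverse_of_injective
    (symPow ℚ 2 V).ker_subtype).choose_spec
  have h2 (x y : V) := LinearMap.congr_fun h (symMul x y)
  simp only [LinearMap.comp_apply, Submodule.subtype_apply, LinearMap.id_apply, symMul] at h2
  simp only [polarThree, symMul, LinearMap.comp_apply, Submodule.subtype_apply, coe_symMulVec,
    differential_mul_three, map_add, LinearMap.lTensor_tmul, h2]

end SymLow

end PentagonalMassey
end

noncomputable section

namespace PentagonalMassey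

namespace Hook

variable {V W : Type*} [AddCommGroup V] [Module ℚ V] [AddCommGroup W] [Module ℚ W]

/-! ### Wedge products of two vectors -/

theorem update_pair_zero {M : Type*} (a b x : M) : Function.update ![a, b] 0 x = ![x, b] := by
  ext i; fin_cases i <;> rfl

theorem update_pair_one {M : Type*} (a b x : M) : Function.update ![a, b] 1 x = ![a, x] := by
  ext i; fin_cases i <;> rfl

/-- The bilinear map `(a, b) ↦ a ∧ b`. -/
def wedge (M : Type*) [AddCommGroup M] [Module ℚ M] : M →ₗ[ℚ] M →ₗ[ℚ] ⋀[ℚ]^2 M :=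
  LinearMap.mk₂ ℚ (fun a b => exteriorPower.ιMulti ℚ 2 ![a, b])
    (fun a a' b => by
      simpa only [update_pair_zero] using
        (exteriorPower.ιMulti ℚ 2 (M := M)).map_update_add ![a, b] 0 a a')
    (fun c a b => by
      simpa only [update_pair_zero] using
        (exteriorPower.ιMulti ℚ 2 (M := M)).map_update_smul ![a, b] 0 c a)
    (fun a b b' => by
      simpa only [update_pair_one] using
        (exteriorPower.ιMulti ℚ 2 (M := M)).map_update_add ![a, b] 1 b b')
    (fun c a b => by
      simpa only [update_pair_one] using
        (exteriorPower.ιMulti ℚ 2 (M := M)).map_update_smul ![a, b] 1 c b)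

theorem wedge_apply {M : Type*} [AddCommGroup M] [Module ℚ M] (a b : M) :
    wedge M a b = exteriorPower.ιMulti ℚ 2 ![a, b] := rfl

theorem wedge_self {M : Type*} [AddCommGroup M] [Module ℚ M] (a : M) : wedge M a a = 0 :=
  (exteriorPower.ιMulti ℚ 2 (M := M)).map_eq_zero_of_eq ![a, a] (i := 0) (j := 1) rfl (by decide)

theorem wedge_swap {M : Type*} [AddCommGroup M] [Module ℚ M] (a b : M) :
    wedge M b a = - wedge M a b := by
  have h := wedge_self (a + b)
  simp only [map_add, LinearMap.add_apply, wedge_self] at h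
  rw [eq_neg_iff_add_eq_zero, ← h]
  abel

/-- The linear map on `Λ²M` induced by antisymmetrizing a bilinear map on `M`. -/
def wedgeLift {M X : Type*} [AddCommGroup M] [Module ℚ M] [AddCommGroup X] [Module ℚ X]
    (B : M →ₗ[ℚ] M →ₗ[ℚ] X) : ⋀[ℚ]^2 M →ₗ[ℚ] X :=
  exteriorPower.alternatingMapLinearEquiv
    { toFun v := B (v 0) (v 1) - B (v 1) (v 0)
      map_update_add' := by
        intro _ v i x y
        fin_cases i <;> simp <;> abel
      map_update_smul' := by
        intro _ v i c x
        fin_cases i <;> simp [smul_sub]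
      map_eq_zero_of_eq' := by
        intro v i j hij hne
        fin_cases i <;> fin_cases j <;> simp_all }

theorem wedgeLift_wedge {M X : Type*} [AddCommGroup M] [Module ℚ M] [AddCommGroup X] [Module ℚ X]
    (B : M →ₗ[ℚ] M →ₗ[ℚ] X) (a b : M) : wedgeLift B (wedge M a b) = B a b - B b a :=
  exteriorPower.alternatingMapLinearEquiv_apply_ιMulti _ _

/-- Linear maps on `Λ²M` agree if they agree on wedge products. -/
theorem ext_wedge {M X : Type*} [AddCommGroup M] [Module ℚ M] [AddCommGroup X] [Module ℚ X]
    {f g : ⋀[ℚ]^2 M →ₗ[ℚ] X} (h : (wedge M).compr₂ f = (wedge M).compr₂ g) : f = g := by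
  refine exteriorPower.linearMap_ext (R := ℚ) (n := 2) ?_
  apply AlternatingMap.ext
  intro v
  have hv : v = ![v 0, v 1] := by ext i; fin_cases i <;> rfl
  rw [hv]
  exact LinearMap.congr_fun₂ h (v 0) (v 1)

/-! ### The ambient space `V ⊗ Λ²P²V` -/

variable (V) in
/-- The space `V ⊗ Λ²P²V`. -/
abbrev Amb : Type _ := V ⊗[ℚ] (⋀[ℚ]^2 (symPow ℚ 2 V))

/-- The element `q ⊗ (xy ∧ zw)`. -/
def E (q x y z w : V) : Amb V := q ⊗ₜ wedge _ (symMul x y) (symMul z w)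

/-- Linear maps on `V ⊗ Λ²P²V` agree if they agree on all `q ⊗ (x² ∧ z²)`. -/
theorem ext_E {f g : Amb V →ₗ[ℚ] W} (h : ∀ q x z, f (E q x x z z) = g (E q x x z z)) : f = g := by
  apply TensorProduct.ext
  apply LinearMap.ext
  intro q
  apply ext_wedge
  apply symPow_two_ext
  intro x
  apply symPow_two_ext
  intro z
  exact h q x z

section E
variable (q x y z w : V)

theorem E_comm_left : E q x y z w = E q y x z w := by rw [E, symMul_comm, E]
theorem E_comm_right : E q x y z w = E q x y w z := by rw [E, symMul_comm z, E]
theorem E_swap : E q z w x y = - E q x y z w := by rw [E, wedge_swap, TensorProduct.tmul_neg, E]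
theorem E_self : E q x y x y = 0 := by rw [E, wedge_self, TensorProduct.tmul_zero]

theorem mMap_E : mMap ℚ V (E q x y z w) =
    symMul x y ⊗ₜ symMulVec ℚ V (symMul z w) q - symMul z w ⊗ₜ symMulVec ℚ V (symMul x y) q :=
  mMap_monomial ℚ V q x y z w

theorem ambientRep_E (g : LinearMap.GeneralLinearGroup ℚ V) :
    ambientRep ℚ V g (E q x y z w) = E ((g : V →ₗ[ℚ] V) q) ((g : V →ₗ[ℚ] V) x)
      ((g : V →ₗ[ℚ] V) y) ((g : V →ₗ[ℚ] V) z) ((g : V →ₗ[ℚ] V) w) := by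
  change TensorProduct.map (g : V →ₗ[ℚ] V)
    (exteriorPower.map 2 (symPowMap 2 (g : V →ₗ[ℚ] V))) (E q x y z w) = _
  rw [E, wedge_apply, TensorProduct.map_tmul, exteriorPower.map_apply_ιMulti, E, wedge_apply]
  congr 2
  ext i
  fin_cases i
  · exact congrArg _ (symPowMap_symMul _ _ _)
  · exact congrArg _ (symPowMap_symMul _ _ _)

end E

/-! ### Maps between `V^{⊗5}`, `V ⊗ Λ²P²V` and `P²V ⊗ P³V` -/

variable (V) in
/-- The map `V^{⊗5} → V ⊗ Λ²P²V` sending a decomposable tensor to `p ⊗ (yq ∧ zr)`. -/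
def toAmb : cellTensor ℚ hook311 V →ₗ[ℚ] Amb V :=
  PiTensorProduct.lift (multilinear (fun p q r y z => E p y q z r)
    (fun q r y z => ⟨by simp [E, TensorProduct.add_tmul], by simp [E, TensorProduct.smul_tmul']⟩)
    (fun p r y z => ⟨by simp [E, symMul_add_right, TensorProduct.tmul_add],
      by simp [E, symMul_smul_right]⟩)
    (fun p q y z => ⟨by simp [E, symMul_add_right, TensorProduct.tmul_add],
      by simp [E, symMul_smul_right]⟩)
    (fun p q r z => ⟨by simp [E, symMul_add_left, TensorProduct.tmul_add],
      by simp [E, symMul_smul_left]⟩)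
    (fun p q r y => ⟨by simp [E, symMul_add_left, TensorProduct.tmul_add],
      by simp [E, symMul_smul_left]⟩))

theorem toAmb_T (p q r y z : V) : toAmb V (T p q r y z) = E p y q z r := lift_T ..

/-- `T` as a linear map in the vectors of a decomposable element of `(V ⊗ V) ⊗ (V ⊗ V)` and the
vector in the corner. -/
def place : V ⊗[ℚ] V →ₗ[ℚ] V ⊗[ℚ] V →ₗ[ℚ] V →ₗ[ℚ] cellTensor ℚ hook311 V :=
  TensorProduct.lift (LinearMap.mk₂ ℚ (fun y q => TensorProduct.lift (LinearMap.mk₂ ℚ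
    (fun z r => (isLinear_T00 q r y z).mk')
    (fun _ _ _ => LinearMap.ext fun _ => T_add20 ..)
    (fun _ _ _ => LinearMap.ext fun _ => T_smul20 ..)
    (fun _ _ _ => LinearMap.ext fun _ => T_add02 ..)
    (fun _ _ _ => LinearMap.ext fun _ => T_smul02 ..)))
    (fun _ _ _ => by ext; exact T_add10 ..)
    (fun _ _ _ => by ext; exact T_smul10 ..)
    (fun _ _ _ => by ext; exact T_add01 ..)
    (fun _ _ _ => by ext; exact T_smul01 ..))

theorem place_tmul (p q r y z : V) : place (y ⊗ₜ q) (z ⊗ₜ r) p = T p q r y z := rfl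

variable (V) in
/-- The map `xy ⊗ t ↦ ∑ z ⊗ (xy ∧ u)`, the sum over the polarization `∑ z ⊗ u` of `t`. -/
def retractFst : symPow ℚ 2 V →ₗ[ℚ] V ⊗[ℚ] symPow ℚ 2 V →ₗ[ℚ] Amb V :=
  LinearMap.mk₂ ℚ (fun b t => LinearMap.lTensor V (wedge _ b) t)
    (by simp [LinearMap.lTensor_add]) (by simp [LinearMap.lTensor_smul]) (by simp) (by simp)

variable (V) in
/-- The map `(x ⊗ y) ⊗ (z ⊗ u) ↦ x ⊗ (yz ∧ u)`. -/
def retractSnd : V ⊗[ℚ] V →ₗ[ℚ] V ⊗[ℚ] symPow ℚ 2 V →ₗ[ℚ] Amb V :=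
  TensorProduct.lift (LinearMap.mk₂ ℚ
    (fun x y => TensorProduct.mk ℚ V _ x ∘ₗ TensorProduct.lift (wedge _ ∘ₗ symMulLin V y))
    (fun _ _ _ => by simp [LinearMap.add_comp]) (fun _ _ _ => by simp [LinearMap.smul_comp])
    (fun _ _ _ => by ext; simp [TensorProduct.tmul_add])
    (fun _ _ _ => by ext; simp))

theorem retractSnd_tmul (x y z : V) (u : symPow ℚ 2 V) :
    retractSnd V (x ⊗ₜ y) (z ⊗ₜ u) = x ⊗ₜ wedge _ (symMul y z) u := rfl

variable [FiniteDimensional ℚ V]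

variable (V) in
/-- A right inverse up to scalars of `toAmb`, obtained by polarization. -/
def ofAmb : Amb V →ₗ[ℚ] cellTensor ℚ hook311 V :=
  TensorProduct.lift (wedgeLift (place.compl₁₂ (polarTwo V) (polarTwo V))).flip

theorem ofAmb_E_sq (q x z : V) : ofAmb V (E q x x z z) =
    (4 : ℚ) • (T q x z x z - T q z x z x) := by
  simp only [ofAmb, E, TensorProduct.lift.tmul, LinearMap.flip_apply, wedgeLift_wedge,
    LinearMap.compl₁₂_apply, polarTwo_symMul, map_add, LinearMap.add_apply, LinearMap.sub_apply,
    place_tmul]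
  module

theorem ofAmb_E (q x y z w : V) : ofAmb V (E q x y z w) =
    T q y w x z + T q x w y z + T q y z x w + T q x z y w
      - T q w y z x - T q w x z y - T q z y w x - T q z x w y := by
  simp only [ofAmb, E, TensorProduct.lift.tmul, LinearMap.flip_apply, wedgeLift_wedge,
    LinearMap.compl₁₂_apply, polarTwo_symMul, map_add, LinearMap.add_apply, LinearMap.sub_apply,
    place_tmul]
  abel

variable (V) in
/-- A map `P²V ⊗ P³V → V ⊗ Λ²P²V` inverting `mMap` on a complement of its kernel. -/
def retract : symPow ℚ 2 V ⊗[ℚ] symPow ℚ 3 V →ₗ[ℚ] Amb V :=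
  TensorProduct.lift ((6 : ℚ) • (retractFst V).compl₂ (polarThree V) -
    (2 : ℚ) • (retractSnd V).compl₁₂ (polarTwo V) (polarThree V))

theorem retract_tmul (x z q : V) :
    retract V (symMul x x ⊗ₜ symMulVec ℚ V (symMul z z) q) =
      (6 : ℚ) • (E q x x z z + (2 : ℚ) • E z x x z q) -
        (4 : ℚ) • (E x x q z z + (2 : ℚ) • E x x z z q) := by
  simp only [retract, TensorProduct.lift.tmul, LinearMap.sub_apply, LinearMap.smul_apply,
    LinearMap.compl₂_apply, LinearMap.compl₁₂_apply, polarTwo_symMul, polarThree_symMulVec,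
    map_add, LinearMap.add_apply, retractSnd_tmul, retractFst, LinearMap.mk₂_apply,
    LinearMap.lTensor_tmul, E]
  module

end Hook

end PentagonalMassey
end

noncomputable section

namespace PentagonalMassey

namespace Hook

variable {V W : Type*} [AddCommGroup V] [Module ℚ V] [AddCommGroup W] [Module ℚ W]

/-! ### The isomorphism of `S(3,1,1)` with `R(V)` -/

/-- The column antisymmetrization of `T x x x y z`. -/
def hookVec (x y z : V) : cellTensor ℚ hook311 V := colAntisymmetrizer ℚ hook311 V (T x x x y z)

theorem hookVec_eq (x y z : V) : hookVec x y z =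
    T x x x y z - T y x x x z - T z x x y x - T x x x z y + T z x x x y + T y x x z x :=
  colAntisymmetrizer_T ..

theorem youngSymmetrizer_T_diag (x y z : V) :
    youngSymmetrizer ℚ hook311 V (T x x x y z) = (6 : ℚ) • hookVec x y z := by
  rw [youngSymmetrizer, LinearMap.comp_apply, rowSymmetrizer_T_diag, map_smul, hookVec]

/-- Linear maps on the tensor power agree on row-symmetric tensors if they agree on tensors
constant on the first row. -/
theorem comp_rowSymmetrizer_ext {f g : cellTensor ℚ hook311 V →ₗ[ℚ] W}
    (h : ∀ x y z, f (T x x x y z) = g (T x x x y z)) :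
    f ∘ₗ rowSymmetrizer ℚ hook311 V = g ∘ₗ rowSymmetrizer ℚ hook311 V := by
  apply ext_T
  intro p q r y z
  simp only [LinearMap.comp_apply, rowSymmetrizer_T_polarization, map_add, map_sub, h]

/-- Linear maps agree on the Weyl module if they agree on the vectors `hookVec x y z`. -/
theorem weyl_ext {f g : cellTensor ℚ hook311 V →ₗ[ℚ] W}
    (h : ∀ x y z : V, f (hookVec x y z) = g (hookVec x y z))
    {t : cellTensor ℚ hook311 V} (ht : t ∈ weyl ℚ hook311 V) : f t = g t := by
  obtain ⟨u, rfl⟩ := ht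
  exact LinearMap.congr_fun (comp_rowSymmetrizer_ext
    (f := f ∘ₗ colAntisymmetrizer ℚ hook311 V) (g := g ∘ₗ colAntisymmetrizer ℚ hook311 V) h) u

/-- The six terms of the antisymmetrization coincide in pairs, because exchanging the two quadratic
factors of the wedge absorbs a sign; this gives the factor 2. -/
theorem toAmb_hookVec (x y z : V) : toAmb V (hookVec x y z) =
    (2 : ℚ) • (E x x y x z - E y x x x z + E z x x x y) := by
  simp only [hookVec_eq, map_add, map_sub, toAmb_T]
  rw [E_comm_left x y x, E_comm_right x x y, E_comm_right y x x z x, E_comm_left z y x x x,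
    E_swap z x x x y, E_comm_left x z x, E_comm_right x x z, E_swap x x y x z, E_comm_right z x x y x,
    E_comm_left y z x x x, E_swap y x x x z]
  module

/-- On the image of `hookVec x y z`, the terms `xy ⊗ x²z`, `xz ⊗ x²y` and `x² ⊗ xyz` each appear
twice with opposite signs. -/
theorem toAmb_mem_R {t : cellTensor ℚ hook311 V} (ht : t ∈ weyl ℚ hook311 V) :
    toAmb V t ∈ R ℚ V := by
  refine weyl_ext (W := symPow ℚ 2 V ⊗[ℚ] symPow ℚ 3 V) (f := mMap ℚ V ∘ₗ toAmb V) (g := 0) ?_ ht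
  intro x y z
  have h (a b c : V) : symMulVec ℚ V (symMul a b) c = symMulVec ℚ V (symMul a c) b :=
    Subtype.ext (by simp only [coe_symMulVec, symMul]; ring)
  simp only [LinearMap.comp_apply, toAmb_hookVec, map_smul, map_add, map_sub, mMap_E,
    LinearMap.zero_apply]
  rw [h x y x, h x z x, h x z y]
  module

variable [FiniteDimensional ℚ V]

/-- Gives injectivity of `toAmb` on the Weyl module; it suffices to expand both sides on `hookVec x
y z`. -/
theorem colAntisymmetrizer_ofAmb_toAmb {t : cellTensor ℚ hook311 V} (ht : t ∈ weyl ℚ hook311 V) :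
    colAntisymmetrizer ℚ hook311 V (ofAmb V (toAmb V t)) = (20 : ℚ) • t := by
  refine weyl_ext (f := colAntisymmetrizer ℚ hook311 V ∘ₗ ofAmb V ∘ₗ toAmb V)
    (g := (20 : ℚ) • LinearMap.id) ?_ ht
  intro x y z
  simp only [LinearMap.comp_apply, toAmb_hookVec, map_smul, map_add, map_sub, ofAmb_E,
    colAntisymmetrizer_T, LinearMap.smul_apply, LinearMap.id_apply]
  rw [hookVec_eq]
  module

/-- The crucial identity for surjectivity onto `R(V)`. The weights 6 and 2 in `retract` are those
for which the error term factors through `mMap`, so that it disappears on the kernel. -/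
theorem toAmb_colAntisymmetrizer_ofAmb (t : Amb V) :
    toAmb V (colAntisymmetrizer ℚ hook311 V (ofAmb V t)) + retract V (mMap ℚ V t) =
      (20 : ℚ) • t := by
  refine LinearMap.congr_fun (f := toAmb V ∘ₗ colAntisymmetrizer ℚ hook311 V ∘ₗ ofAmb V +
    retract V ∘ₗ mMap ℚ V) (g := (20 : ℚ) • LinearMap.id) (ext_E ?_) t
  intro q x z
  simp only [LinearMap.add_apply, LinearMap.comp_apply, ofAmb_E_sq, mMap_E, map_smul, map_sub,
    map_add, colAntisymmetrizer_T, toAmb_T, retract_tmul, LinearMap.smul_apply, LinearMap.id_apply]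
  -- Every term is reduced to one of five normal forms, `q ⊗ (x² ∧ z²)`, `z ⊗ (x² ∧ zq)`, `x ⊗ (xq ∧
  -- z²)`, `x ⊗ (xz ∧ zq)`, `z ⊗ (xz ∧ xq)`, or to zero; coefficients can then be compared.
  have e1 := E_comm_left x q x z z
  have e2 := E_comm_right z x x q z
  have e3 : E q z x x z = 0 := by rw [E_comm_left, E_self]
  have e4 : E z q x x z = -E z x z x q := by rw [E_swap, E_comm_right]
  have e5 : E x z x q z = E x x z z q := by rw [E_comm_left, E_comm_right]
  have e6 := E_swap q x x z z
  have e7 : E q x z z x = 0 := by rw [E_comm_right, E_self]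
  have e8 : E x z z q x = -E x x q z z := by rw [E_swap, e1]
  have e9 : E x q z z x = -E x x z z q := by rw [E_swap, e5]
  have e10 := E_comm_right z x z q x
  have e11 : E z q z x x = -E z x x z q := by rw [E_swap, e2]
  have e12 := E_swap x x q z z
  have e13 := E_swap z x x z q
  have e14 := E_comm_left z z x x q
  simp only [e1, e2, e3, e4, e5, e6, e7, e8, e9, e10, e11, e12, e13, e14]
  module

/-- Needed for all `t`: it places the image of `b ∘ ofAmb` inside the Weyl module without assuming
`t ∈ R(V)`. -/
theorem young_ofAmb (t : Amb V) :
    youngSymmetrizer ℚ hook311 V (colAntisymmetrizer ℚ hook311 V (ofAmb V t)) =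
      (20 : ℚ) • colAntisymmetrizer ℚ hook311 V (ofAmb V t) := by
  refine LinearMap.congr_fun (f := youngSymmetrizer ℚ hook311 V ∘ₗ
    colAntisymmetrizer ℚ hook311 V ∘ₗ ofAmb V)
    (g := (20 : ℚ) • colAntisymmetrizer ℚ hook311 V ∘ₗ ofAmb V) (ext_E ?_) t
  intro q x z
  simp only [youngSymmetrizer, LinearMap.comp_apply, ofAmb_E_sq, map_smul, map_sub,
    map_add, colAntisymmetrizer_T, rowSymmetrizer_T, LinearMap.smul_apply]
  module

/-- The Weyl module of the hook is spanned by eigenvectors of the Young symmetrizer. -/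
theorem young_weyl {t : cellTensor ℚ hook311 V} (ht : t ∈ weyl ℚ hook311 V) :
    youngSymmetrizer ℚ hook311 V t = (20 : ℚ) • t := by
  have h1 := colAntisymmetrizer_ofAmb_toAmb ht
  have h2 := young_ofAmb (toAmb V t)
  rw [h1, map_smul] at h2
  exact smul_right_injective _ (by norm_num : (20 : ℚ) ≠ 0) h2

theorem colAntisymmetrizer_ofAmb_mem_weyl (t : Amb V) :
    colAntisymmetrizer ℚ hook311 V (ofAmb V t) ∈ weyl ℚ hook311 V := by
  refine ⟨(1 / 20 : ℚ) • colAntisymmetrizer ℚ hook311 V (ofAmb V t), ?_⟩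
  rw [map_smul, young_ofAmb]
  module

variable (V) in
/-- The linear isomorphism of `S(3,1,1)` with `R(V)`. -/
def weylEquivR : weyl ℚ hook311 V ≃ₗ[ℚ] R ℚ V where
  __ := (toAmb V).restrict (p := weyl ℚ hook311 V) (q := R ℚ V) fun _ => toAmb_mem_R
  invFun t := ⟨(1 / 20 : ℚ) • colAntisymmetrizer ℚ hook311 V (ofAmb V t),
    Submodule.smul_mem _ _ (colAntisymmetrizer_ofAmb_mem_weyl _)⟩
  left_inv t := by
    apply Subtype.ext
    change (1 / 20 : ℚ) • colAntisymmetrizer ℚ hook311 V (ofAmb V (toAmb V t)) = _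
    rw [colAntisymmetrizer_ofAmb_toAmb t.2]
    module
  right_inv t := by
    apply Subtype.ext
    change toAmb V ((1 / 20 : ℚ) • colAntisymmetrizer ℚ hook311 V (ofAmb V t)) = _
    have h := toAmb_colAntisymmetrizer_ofAmb (t : Amb V)
    have h0 : mMap ℚ V t = 0 := t.2
    rw [h0, map_zero, add_zero] at h
    rw [map_smul, h]
    module

omit [FiniteDimensional ℚ V] in
theorem toAmb_equivariant (g : LinearMap.GeneralLinearGroup ℚ V) (t : cellTensor ℚ hook311 V) :
    toAmb V (tensorRep ℚ hook311 V g t) = ambientRep ℚ V g (toAmb V t) := by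
  refine LinearMap.congr_fun (f := toAmb V ∘ₗ tensorRep ℚ hook311 V g)
    (g := ambientRep ℚ V g ∘ₗ toAmb V) (ext_T ?_) t
  intro p q r y z
  rw [LinearMap.comp_apply, LinearMap.comp_apply, toAmb_T, ambientRep_E]
  change toAmb V (PiTensorProduct.map (fun _ => (g : V →ₗ[ℚ] V)) (T p q r y z)) = _
  rw [map_T, toAmb_T]

variable (V) in
/-- The isomorphism of representations of `S(3,1,1)` with `R(V)`. -/
def weylRepEquivRRep : (weylRep ℚ hook311 V).Equiv (RRep ℚ V) :=
  Representation.Equiv.mk (weylEquivR V) fun g => by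
    ext t
    exact toAmb_equivariant g t

end Hook
end PentagonalMassey
end

noncomputable section

namespace PentagonalMassey

namespace Hook

variable {V : Type*} [AddCommGroup V] [Module ℚ V] 

/-! ### The dimension of `S(3,1,1)` -/

theorem vecEquiv_apply {X : Type*} (p q r y z : X) :
    vecEquiv X (p, q, r, y, z) = vec p q r y z := rfl

theorem coord_T {ι : Type*} (e : Module.Basis ι ℚ V) (p q r y z : V) (i j k l m : ι) :
    (Basis.piTensorProduct fun _ : hook311.cells => e).repr (T p q r y z) (vec i j k l m) =
      e.repr p i * e.repr q j * e.repr r k * e.repr y l * e.repr z m := by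
  rw [T, Basis.piTensorProduct_repr_tprod_apply, prod_cells]
  rfl

theorem basis_vec {ι : Type*} [Finite ι] (e : Module.Basis ι ℚ V) (i j k l m : ι) :
    (Basis.piTensorProduct fun _ : hook311.cells => e) (vec i j k l m) =
      T (e i) (e j) (e k) (e l) (e m) := by
  rw [Basis.piTensorProduct_apply, T, comp_vec]

/-- A permutation of the tensor factors has trace `n` to the number of its cycles, so the 36
products of a column and a row permutation contribute signed powers of `n`. In the tensor basis this
becomes a sum of products of Kronecker deltas. The total is `(n-2)(n-1)n(n+1)(n+2)`. -/
theorem trace_youngSymmetrizer (V : Type*) [AddCommGroup V] [Module ℚ V] [FiniteDimensional ℚ V]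
    {n : ℕ} (hn : Module.finrank ℚ V = n) :
    LinearMap.trace ℚ _ (youngSymmetrizer ℚ hook311 V) = (n : ℚ) ^ 5 - 5 * n ^ 3 + 4 * n := by
  let e : Module.Basis (Fin n) ℚ V := Module.finBasisOfFinrankEq ℚ V hn
  rw [LinearMap.trace_eq_matrix_trace ℚ (Basis.piTensorProduct fun _ : hook311.cells => e),
    Matrix.trace, ← (vecEquiv (Fin n)).sum_comp]
  simp only [Fintype.sum_prod_type, Matrix.diag_apply, LinearMap.toMatrix_apply, vecEquiv_apply,
    basis_vec, youngSymmetrizer, LinearMap.comp_apply, rowSymmetrizer_T, map_add,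
    colAntisymmetrizer_T, map_sub, Finsupp.add_apply, Finsupp.sub_apply, coord_T,
    Module.Basis.repr_self, Finsupp.single_apply, Finset.sum_add_distrib, Finset.sum_sub_distrib]
  simp
  ring

/-- The rank of a projection is its trace, here `120 * (n + 2).choose 5 / 20`. -/
theorem finrank_weyl (V : Type*) [AddCommGroup V] [Module ℚ V] [FiniteDimensional ℚ V]
    {n : ℕ} (hn : Module.finrank ℚ V = n) :
    Module.finrank ℚ (weyl ℚ hook311 V) = 6 * (n + 2).choose 5 := by
  have hp : LinearMap.IsProj (weyl ℚ hook311 V) ((1 / 20 : ℚ) • youngSymmetrizer ℚ hook311 V) :=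
    ⟨fun x => Submodule.smul_mem _ _ ⟨x, rfl⟩, fun x hx => by
      rw [LinearMap.smul_apply, young_weyl hx]; module⟩
  have h := hp.trace
  rw [map_smul, trace_youngSymmetrizer V hn, smul_eq_mul] at h
  have hc : ((n : ℚ) ^ 5 - 5 * n ^ 3 + 4 * n) = 120 * ((n + 2).choose 5 : ℕ) := by
    -- The last factor of the falling factorial is `n - 2`; splitting off `n = 0, 1` avoids
    -- truncated subtraction.
    obtain _ | _ | m := n
    · norm_num [Nat.choose]
    · norm_num [Nat.choose]
    · have hd := Nat.descFactorial_eq_factorial_mul_choose (m + 1 + 1 + 2) 5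
      rw [show Nat.factorial 5 = 120 from rfl] at hd
      rw [← Nat.cast_ofNat (R := ℚ) (n := 120), ← Nat.cast_mul, ← hd]
      simp only [Nat.descFactorial, Nat.sub_zero, show m + 1 + 1 + 2 - 4 = m by omega,
        show m + 1 + 1 + 2 - 3 = m + 1 by omega, show m + 1 + 1 + 2 - 2 = m + 2 by omega,
        show m + 1 + 1 + 2 - 1 = m + 3 by omega]
      push_cast
      ring
  rw [hc] at h
  have h' : (Module.finrank ℚ (weyl ℚ hook311 V) : ℚ) = (6 * (n + 2).choose 5 : ℕ) := by
    rw [← h]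
    push_cast
    ring
  exact_mod_cast h'

end Hook
end PentagonalMassey
end

noncomputable section

namespace PentagonalMassey

namespace Hook

variable {V : Type*} [AddCommGroup V] [Module ℚ V]

/-! ### Irreducibility of `S(3,1,1)` -/

/-- If a polynomial curve takes values in a subspace for infinitely many values of the parameter,
then its coefficients lie in the subspace. -/
theorem coeff_mem_of_infinite {M : Type*} [AddCommGroup M] [Module ℚ M] (W : Submodule ℚ M) {n : ℕ}
    (u : ℕ → M) {S : Set ℚ} (hS : S.Infinite)
    (h : ∀ t ∈ S, ∑ k ∈ Finset.range n, t ^ k • u k ∈ W) {k : ℕ} (hk : k < n) : u k ∈ W := by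
  by_contra hu
  -- A linear form vanishing on `W` but not at `u k` turns the curve into a scalar polynomial with
  -- infinitely many roots.
  obtain ⟨f, hf, hW⟩ := Submodule.exists_le_ker_of_notMem hu
  let p : Polynomial ℚ := ∑ k ∈ Finset.range n, Polynomial.monomial k (f (u k))
  have hp : p = 0 := by
    refine Polynomial.eq_zero_of_infinite_isRoot p (hS.mono fun t ht => ?_)
    have := LinearMap.mem_ker.1 (hW (h t ht))
    rw [map_sum] at this
    rw [Set.mem_ofPred_eq, Polynomial.IsRoot, Polynomial.eval_finsetSum, ← this]
    refine Finset.sum_congr rfl fun i _ => ?_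
    rw [Polynomial.eval_monomial, map_smul, smul_eq_mul, mul_comm]
  have hc : p.coeff k = f (u k) := by
    simp only [p, Polynomial.finsetSum_coeff, Polynomial.coeff_monomial]
    rw [Finset.sum_ite_eq' (Finset.range n) k, if_pos (Finset.mem_range.2 hk)]
  exact hf (by rw [← hc, hp, Polynomial.coeff_zero])

/-- The diagonal action of the pencil `A + t B` is polynomial in `t`. -/
theorem exists_map_pencil (A B : V →ₗ[ℚ] V) :
    ∃ u : ℕ → (cellTensor ℚ hook311 V →ₗ[ℚ] cellTensor ℚ hook311 V),
      u 0 = PiTensorProduct.map (fun _ => A) ∧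
      ∀ t : ℚ, PiTensorProduct.map (fun _ => A + t • B) = ∑ k ∈ Finset.range 6, t ^ k • u k := by
  let m (s : Finset hook311.cells) : cellTensor ℚ hook311 V →ₗ[ℚ] cellTensor ℚ hook311 V :=
    PiTensorProduct.map (s.piecewise (fun _ => B) fun _ => A)
  -- The `t ^ k` coefficient collects the choices of `k` cells on which `B` acts; with five cells
  -- the degree is at most 5.
  refine ⟨fun k => ∑ s : Finset hook311.cells with s.card = k, m s, ?_, fun t => ?_⟩
  · have : (Finset.univ.filter fun s : Finset hook311.cells => s.card = 0) = {∅} := by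
      ext s; simp
    simp only [this, Finset.sum_singleton, m, Finset.piecewise_empty]
  · have h := (PiTensorProduct.mapMultilinear ℚ (fun _ : hook311.cells => V) fun _ => V).map_add_univ
      (fun _ => t • B) (fun _ => A)
    have h2 (s : Finset hook311.cells) :
        PiTensorProduct.map (s.piecewise (fun _ => t • B) fun _ => A) = t ^ s.card • m s := by
      have := (PiTensorProduct.mapMultilinear ℚ (fun _ : hook311.cells => V)
        fun _ => V).map_piecewise_smul (fun _ => t) (s.piecewise (fun _ => B) fun _ => A) s
      rw [Finset.prod_const] at this
      simp only [PiTensorProduct.mapMultilinear_apply] at this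
      rw [← this]
      congr 1
      funext c
      by_cases hc : c ∈ s <;> simp [hc]
    simp only [PiTensorProduct.mapMultilinear_apply, h2] at h
    have e : (fun _ : hook311.cells => A + t • B) = (fun _ => t • B) + fun _ => A := by
      funext c
      exact add_comm _ _
    rw [e, h, ← Finset.sum_fiberwise_of_maps_to (s := Finset.univ) (t := Finset.range 6)
      (g := fun s : Finset hook311.cells => s.card)]
    · refine Finset.sum_congr rfl fun k _ => ?_
      rw [Finset.smul_sum]
      refine Finset.sum_congr rfl fun s hs => ?_
      rw [(Finset.mem_filter.1 hs).2]
    · intro s _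
      have h5 : Fintype.card hook311.cells = 5 := by decide
      have := s.card_le_univ
      rw [Finset.mem_range]
      omega

/-- A subspace of the tensor power stable under `GL(V)` is stable under all of `End(V)`. -/
theorem map_mem_of_stable [FiniteDimensional ℚ V] {W : Submodule ℚ (cellTensor ℚ hook311 V)}
    (hW : ∀ g, ∀ w ∈ W, tensorRep ℚ hook311 V g w ∈ W) (A : V →ₗ[ℚ] V)
    {w : cellTensor ℚ hook311 V} (hw : w ∈ W) : PiTensorProduct.map (fun _ => A) w ∈ W := by
  obtain ⟨u, hu0, hu⟩ := exists_map_pencil A LinearMap.id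
  rw [← hu0]
  -- `A + t` is invertible exactly when `t` is not in the spectrum of `-A`, which is finite; the
  -- action of `A` is the constant coefficient.
  refine coeff_mem_of_infinite W (n := 6) (fun k => u k w)
    (Module.End.finite_spectrum (-A)).infinite_compl (fun t ht => ?_) (by norm_num)
  have ht' : IsUnit (A + t • LinearMap.id : Module.End ℚ V) := by
    have := not_not.1 ht
    rwa [spectrum.mem_resolventSet_iff, sub_neg_eq_add, add_comm, Algebra.algebraMap_eq_smul_one] at this
  obtain ⟨g, hg⟩ := ht'
  have h := hW g w hw
  change PiTensorProduct.map (fun _ => (g : V →ₗ[ℚ] V)) w ∈ W at h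
  rw [hg, hu, LinearMap.sum_apply] at h
  exact h

/-- The linear form on the tensor power given by a tensor of linear forms. -/
abbrev pairing : cellTensor ℚ hook311 (Module.Dual ℚ V) →ₗ[ℚ]
    Module.Dual ℚ (cellTensor ℚ hook311 V) :=
  PiTensorProduct.dualDistrib

theorem pairing_T (φ₁ φ₂ φ₃ φ₄ φ₅ : Module.Dual ℚ V) (p q r y z : V) :
    pairing (T φ₁ φ₂ φ₃ φ₄ φ₅) (T p q r y z) = φ₁ p * φ₂ q * φ₃ r * φ₄ y * φ₅ z := by
  rw [T, T, pairing, PiTensorProduct.dualDistrib_apply, prod_cells]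
  rfl

/-- The adjoint of a permutation is its inverse, and the row permutations form a group. -/
theorem pairing_rowSymmetrizer (η : cellTensor ℚ hook311 (Module.Dual ℚ V))
    (t : cellTensor ℚ hook311 V) :
    pairing (rowSymmetrizer ℚ hook311 _ η) t = pairing η (rowSymmetrizer ℚ hook311 V t) := by
  have h : pairing ∘ₗ rowSymmetrizer ℚ hook311 (Module.Dual ℚ V) =
      (LinearMap.lcomp ℚ ℚ (rowSymmetrizer ℚ hook311 V)) ∘ₗ pairing := by
    apply ext_T
    intro φ₁ φ₂ φ₃ φ₄ φ₅
    apply ext_T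
    intro p q r y z
    simp only [LinearMap.comp_apply, LinearMap.lcomp_apply, rowSymmetrizer_T, map_add,
      LinearMap.add_apply, pairing_T]
    ring
  exact LinearMap.congr_fun₂ h η t

/-- A nonzero vector of the Weyl module pairs nontrivially with some `φ⊗φ⊗φ⊗χ⊗ψ`. -/
theorem exists_pairing_ne_zero [FiniteDimensional ℚ V] {w : cellTensor ℚ hook311 V}
    (hw : w ∈ weyl ℚ hook311 V) (h0 : w ≠ 0) :
    ∃ φ χ ψ : Module.Dual ℚ V, pairing (T φ φ φ χ ψ) w ≠ 0 := by
  by_contra! H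
  have h1 := comp_rowSymmetrizer_ext (V := Module.Dual ℚ V) (f := pairing.flip w) (g := 0) H
  -- By polarization every row-symmetrized dual tensor kills `w`, hence every dual tensor kills its
  -- row symmetrization; this contradicts `c w = 20 w ≠ 0`.
  have h2 : rowSymmetrizer ℚ hook311 V w = 0 := by
    refine (Module.forall_dual_apply_eq_zero_iff ℚ _).1 fun f => ?_
    obtain ⟨η, rfl⟩ := (PiTensorProduct.dualDistribEquiv (R := ℚ)
      (M := fun _ : hook311.cells => V)).surjective f
    change pairing η _ = 0
    rw [← pairing_rowSymmetrizer]
    exact LinearMap.congr_fun h1 η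
  have h3 := young_weyl hw
  rw [youngSymmetrizer, LinearMap.comp_apply, h2, map_zero] at h3
  exact h0 ((smul_eq_zero.1 h3.symm).resolve_left (by norm_num))

section leading

variable (φ χ ψ : Module.Dual ℚ V) (x y z : V)

/-- The determinant identity for antisymmetrized tensors. -/
theorem colAntisymmetrizer_det (a b : V) (p₁ p₂ p₃ q₁ q₂ q₃ r₁ r₂ r₃ : ℚ) :
    colAntisymmetrizer ℚ hook311 V (T (p₁ • x + (p₂ • y + p₃ • z)) a b
      (q₁ • x + (q₂ • y + q₃ • z)) (r₁ • x + (r₂ • y + r₃ • z))) =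
    (p₁ * (q₂ * r₃ - q₃ * r₂) - p₂ * (q₁ * r₃ - q₃ * r₁) + p₃ * (q₁ * r₂ - q₂ * r₁)) •
      colAntisymmetrizer ℚ hook311 V (T x a b y z) := by
  have s1 (p q r : V) : colAntisymmetrizer ℚ hook311 V (T q a b p r) =
      - colAntisymmetrizer ℚ hook311 V (T p a b q r) := by
    simp only [colAntisymmetrizer_T]; abel
  have s2 (p q r : V) : colAntisymmetrizer ℚ hook311 V (T p a b r q) =
      - colAntisymmetrizer ℚ hook311 V (T p a b q r) := by
    simp only [colAntisymmetrizer_T]; abel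
  have z1 (p r : V) : colAntisymmetrizer ℚ hook311 V (T p a b p r) = 0 := by
    simp only [colAntisymmetrizer_T]; abel
  have z2 (p r : V) : colAntisymmetrizer ℚ hook311 V (T p a b r r) = 0 := by
    simp only [colAntisymmetrizer_T]; abel
  have z3 (p r : V) : colAntisymmetrizer ℚ hook311 V (T p a b r p) = 0 := by
    simp only [colAntisymmetrizer_T]; abel
  simp only [T_add00, T_add10, T_add20, T_smul00, T_smul10, T_smul20, map_add, map_smul, z1, z2, z3,
    smul_zero, add_zero, zero_add]
  rw [s1 x y z, s2 x y z, s1 x z y, s2 x y z, s2 y x z, s1 x y z, s2 z x y, s1 x z y, s2 x y z]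
  module

/-- The leading coefficient, in `t`, of the action of `t • x φ + y χ + z ψ` on an antisymmetrized
tensor. -/
theorem exists_map_colAntisymmetrizer (v : cellTensor ℚ hook311 V) :
    ∃ u : ℕ → cellTensor ℚ hook311 V,
      u 3 = pairing (T φ φ φ χ ψ) (colAntisymmetrizer ℚ hook311 V v) • hookVec x y z ∧
      ∀ t : ℚ, PiTensorProduct.map
        (fun _ => (χ.smulRight y + ψ.smulRight z) + t • φ.smulRight x)
          (colAntisymmetrizer ℚ hook311 V v) = ∑ k ∈ Finset.range 6, t ^ k • u k := by
  obtain ⟨u, -, hu⟩ := exists_map_pencil (χ.smulRight y + ψ.smulRight z) (φ.smulRight x)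
  refine ⟨fun k => u k (colAntisymmetrizer ℚ hook311 V v), ?_, fun t => by
    rw [hu, LinearMap.sum_apply]; rfl⟩
  refine LinearMap.congr_fun (f := u 3 ∘ₗ colAntisymmetrizer ℚ hook311 V)
    (g := (pairing (T φ φ φ χ ψ) ∘ₗ colAntisymmetrizer ℚ hook311 V).smulRight (hookVec x y z))
    (ext_T fun p q r p' p'' => ?_) v
  let c (a : V) : V := χ a • y + ψ a • z
  let d : ℚ := φ p * (χ p' * ψ p'' - ψ p' * χ p'') - χ p * (φ p' * ψ p'' - ψ p' * φ p'') +
    ψ p * (φ p' * χ p'' - χ p' * φ p'')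
  let B (a b : V) := colAntisymmetrizer ℚ hook311 V (T x a b y z)
  -- The three column slots contribute the determinant `t * d` of their coordinates along `x, y, z`,
  -- hence exactly one factor `t`. The two remaining row slots contribute at most `t` each, so the
  -- top degree is 3.
  let w : ℕ → cellTensor ℚ hook311 V := fun k =>
    if k = 3 then (d * (φ q * φ r)) • hookVec x y z
    else if k = 2 then d • (φ q • B x (c r) + φ r • B (c q) x)
    else if k = 1 then d • B (c q) (c r) else 0
  have key (t : ℚ) : PiTensorProduct.map
      (fun _ => (χ.smulRight y + ψ.smulRight z) + t • φ.smulRight x)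
        (colAntisymmetrizer ℚ hook311 V (T p q r p' p'')) = ∑ k ∈ Finset.range 6, t ^ k • w k := by
    have hA (a : V) : ((χ.smulRight y + ψ.smulRight z) + t • φ.smulRight x) a =
        (t * φ a) • x + c a := by
      simp only [LinearMap.add_apply, LinearMap.smul_apply, LinearMap.smulRight_apply, c]
      module
    have hcol : PiTensorProduct.map (fun _ => (χ.smulRight y + ψ.smulRight z) + t • φ.smulRight x)
        (colAntisymmetrizer ℚ hook311 V (T p q r p' p'')) =
        colAntisymmetrizer ℚ hook311 V (T ((t * φ p) • x + c p) ((t * φ q) • x + c q)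
          ((t * φ r) • x + c r) ((t * φ p') • x + c p') ((t * φ p'') • x + c p'')) := by
      simp only [colAntisymmetrizer_T, map_add, map_sub, map_T, hA]
    rw [hcol, colAntisymmetrizer_det]
    simp only [T_add01, T_add02, T_smul01, T_smul02, map_add, map_smul, Finset.sum_range_succ,
      Finset.sum_range_zero, w, hookVec, B, d]
    norm_num only [if_true, if_false]
    module
  -- Two polynomial expressions for the same curve have equal coefficients: the coefficient lemma
  -- for the zero subspace.
  have h3 : u 3 (colAntisymmetrizer ℚ hook311 V (T p q r p' p'')) - w 3 ∈
      (⊥ : Submodule ℚ (cellTensor ℚ hook311 V)) := by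
    refine coeff_mem_of_infinite ⊥ (n := 6)
      (fun k => u k (colAntisymmetrizer ℚ hook311 V (T p q r p' p'')) - w k)
      (Set.infinite_univ (α := ℚ)) (fun t _ => ?_) (by norm_num)
    simp only [smul_sub, Finset.sum_sub_distrib]
    rw [← key, hu, LinearMap.sum_apply, Submodule.mem_bot, sub_eq_zero]
    rfl
  rw [Submodule.mem_bot, sub_eq_zero] at h3
  rw [LinearMap.comp_apply, h3, LinearMap.smulRight_apply, LinearMap.comp_apply,
    colAntisymmetrizer_T]
  simp only [w, if_true, map_add, map_sub, pairing_T, d]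
  congr 1
  ring

end leading

/-- A `GL(V)`-stable subspace of `S(3,1,1)` is zero or everything. -/
theorem eq_bot_or_eq_weyl [FiniteDimensional ℚ V] {W : Submodule ℚ (cellTensor ℚ hook311 V)}
    (hle : W ≤ weyl ℚ hook311 V) (hW : ∀ g, ∀ w ∈ W, tensorRep ℚ hook311 V g w ∈ W) :
    W = ⊥ ∨ W = weyl ℚ hook311 V := by
  by_cases hbot : W = ⊥
  · exact Or.inl hbot
  refine Or.inr (le_antisymm hle ?_)
  obtain ⟨w, hw, h0⟩ := W.ne_bot_iff.1 hbot
  obtain ⟨φ, χ, ψ, hp⟩ := exists_pairing_ne_zero (hle hw) h0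
  have hhook (x y z : V) : hookVec x y z ∈ W := by
    obtain ⟨v, hv⟩ := hle hw
    obtain ⟨u, hu3, hu⟩ := exists_map_colAntisymmetrizer φ χ ψ x y z
      (rowSymmetrizer ℚ hook311 V v)
    change colAntisymmetrizer ℚ hook311 V (rowSymmetrizer ℚ hook311 V v) = w at hv
    rw [hv] at hu3 hu
    have h3 : u 3 ∈ W := coeff_mem_of_infinite W (n := 6) u (Set.infinite_univ (α := ℚ))
      (fun t _ => by rw [← hu]; exact map_mem_of_stable hW _ hw) (by norm_num)
    rw [hu3] at h3
    exact (W.smul_mem_iff hp).1 h3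
  intro t ht
  -- The quotient map by `W` kills all the spanning vectors, hence the whole Weyl module.
  have := weyl_ext (f := W.mkQ) (g := 0)
    (fun x y z => by simpa using hhook x y z) ht
  simpa using this

end Hook
end PentagonalMassey
end

noncomputable section

namespace PentagonalMassey

namespace Hook

/-! ### Transfer of dimension and irreducibility to `R(V)` -/

variable {V : Type*} [AddCommGroup V] [Module ℚ V] [FiniteDimensional ℚ V]

theorem finrank_R {n : ℕ} (hn : Module.finrank ℚ V = n) :
    Module.finrank ℚ (R ℚ V) = 6 * (n + 2).choose 5 := by
  rw [← finrank_weyl V hn, (weylEquivR V).finrank_eq]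

/-- Irreducibility is invariant under isomorphism of representations. -/
theorem isIrreducible_of_equiv {k G M N : Type*} [Field k] [Monoid G] [AddCommGroup M] [Module k M]
    [AddCommGroup N] [Module k N] {ρ : Representation k G M} {σ : Representation k G N}
    (e : ρ.Equiv σ) (hσ : σ.IsIrreducible) : ρ.IsIrreducible := by
  let F (S : Subrepresentation ρ) : Subrepresentation σ :=
    { toSubmodule := S.toSubmodule.map e.toLinearEquiv.toLinearMap
      apply_mem_toSubmodule := by
        rintro g _ ⟨s, hs, rfl⟩
        exact ⟨ρ g s, S.apply_mem_toSubmodule g hs, LinearMap.congr_fun (e.isIntertwining' g) s⟩ }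
  have hF : Function.Injective F := fun S S' h =>
    Subrepresentation.toSubmodule_injective
      (Submodule.map_injective_of_injective e.toLinearEquiv.injective
        (congrArg Subrepresentation.toSubmodule h))
  have hbot : F ⊥ = ⊥ := Subrepresentation.toSubmodule_injective (Submodule.map_bot _)
  have htop : F ⊤ = ⊤ := Subrepresentation.toSubmodule_injective
    ((Submodule.map_top _).trans e.toLinearEquiv.range)
  refine { exists_pair_ne := ⟨⊥, ⊤, fun h => ?_⟩, eq_bot_or_eq_top := fun S => ?_ }
  · exact bot_ne_top (α := Subrepresentation σ) (by rw [← hbot, ← htop, h])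
  · rcases hσ.eq_bot_or_eq_top (F S) with h | h
    · exact Or.inl (hF (h.trans hbot.symm))
    · exact Or.inr (hF (h.trans htop.symm))

/-- `S(3,1,1)` is irreducible as soon as it is nonzero. -/
theorem isIrreducible_weylRep (h3 : 3 ≤ Module.finrank ℚ V) :
    (weylRep ℚ hook311 V).IsIrreducible := by
  have hpos : 0 < Module.finrank ℚ (weyl ℚ hook311 V) := by
    rw [finrank_weyl V rfl]
    have := Nat.choose_pos (n := Module.finrank ℚ V + 2) (k := 5) (by omega)
    omega
  have : Nontrivial (weyl ℚ hook311 V) := Module.nontrivial_of_finrank_pos hpos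
  refine { exists_pair_ne := ⟨⊥, ⊤, fun h => ?_⟩, eq_bot_or_eq_top := fun S => ?_ }
  · have h' := congrArg Subrepresentation.toSubmodule h
    exact bot_ne_top (α := Submodule ℚ (weyl ℚ hook311 V)) h'
  -- A subrepresentation is pushed into the tensor power, where the dichotomy for stable subspaces
  -- applies, and pulled back by injectivity.
  · have hinj := (weyl ℚ hook311 V).injective_subtype
    have hst : ∀ g, ∀ w ∈ S.toSubmodule.map (weyl ℚ hook311 V).subtype,
        tensorRep ℚ hook311 V g w ∈ S.toSubmodule.map (weyl ℚ hook311 V).subtype := by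
      rintro g _ ⟨s, hs, rfl⟩
      exact ⟨weylRep ℚ hook311 V g s, S.apply_mem_toSubmodule g hs, rfl⟩
    rcases eq_bot_or_eq_weyl (Submodule.map_subtype_le _ _) hst with h | h
    · left
      apply Subrepresentation.toSubmodule_injective
      apply Submodule.map_injective_of_injective hinj
      exact h.trans (Submodule.map_bot _).symm
    · right
      apply Subrepresentation.toSubmodule_injective
      apply Submodule.map_injective_of_injective hinj
      exact h.trans (Submodule.map_subtype_top _).symm

end Hook
end PentagonalMassey
end

/-- The dimension of `R(V)`; its identification with the Weyl module `S(3,1,1)` as a representation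
of `GL(V)`; and its irreducibility, which needs `r ≥ 3` since `R(V)` and `S(3,1,1)` are zero for
`r ≤ 2`. -/
theorem lemma2p1 {V : Type*} [AddCommGroup V] [Module ℚ V] [FiniteDimensional ℚ V]
    (r : ℕ) (hr : Module.finrank ℚ V = r) :
    (FiniteDimensional ℚ (PentagonalMassey.R ℚ V) ∧
      Module.finrank ℚ (PentagonalMassey.R ℚ V) = 6 * (r + 2).choose 5) ∧
    (Nonempty ((PentagonalMassey.RRep ℚ V).Equiv
        (PentagonalMassey.weylRep ℚ PentagonalMassey.hook311 V)) ∧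
      (3 ≤ r → (PentagonalMassey.RRep ℚ V).IsIrreducible)) :=
  ⟨⟨(PentagonalMassey.Hook.weylEquivR V).finiteDimensional, PentagonalMassey.Hook.finrank_R hr⟩,
    ⟨(PentagonalMassey.Hook.weylRepEquivRRep V).symm⟩,
    fun h => PentagonalMassey.Hook.isIrreducible_of_equiv
      (PentagonalMassey.Hook.weylRepEquivRRep V).symm
      (PentagonalMassey.Hook.isIrreducible_weylRep (hr ▸ h))⟩
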